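/- Let $\varphi_0(z)=e^z$ and $\varphi_j(z)=\int_0^1 e^{(1-s)z}\frac{s^{j-1}}{(j-1)!}\,ds$ for $j\ge1$. The three-stage explicit exponential Runge–Kutta method EERK3-2 with abscissas $c_2=\tfrac34$, $c_3=\tfrac35$ has, with $\gamma=\frac{(3c_3-2)c_3}{(2-3c_2)c_2}=\tfrac{16}{25}$, the coefficients $$a_{21}(z)=c_2\varphi_1(c_2z),\quad a_{32}(z)=\gamma c_2\varphi_2(c_2z)+\tfrac{c_3^2}{c_2}\varphi_2(c_3z),\quad a_{31}(z)=c_3\varphi_1(c_3z)-a_{32}(z),$$ $$a_{42}(z)=\tfrac{\gamma}{\gamma c_2+c_3}\varphi_2(z),\quad a_{43}(z)=\tfrac{1}{\gamma c_2+c_3}\varphi_2(z),\quad a_{41}(z)=\varphi_1(z)-a_{42}(z)-a_{43}(z).$$ Put $\underline a_{i+1,i}=a_{i+1,i}$ and $\underline a_{i+1,j}=a_{i+1,j}-a_{i,j}$ for $1\le j<i\le 3$; define $\theta_{k,k}=1/\underline a_{k+1,k}$ and $\theta_{k,j}=-\sum_{\ell=j+1}^{k}\theta_{k,\ell}\,\underline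 a_{\ell+1,j}/\underline a_{j+1,j}$ for $1\le j<k\le 3$; and let $D(z)=(d_{k\ell}(z))_{1\le k,\ell\le3}$ be the lower triangular matrix with $d_{k\ell}(z)=\theta_{k,\ell}(z)+\frac z2(2-\delta_{k\ell})$ for $\ell\le k$. Let $L_h\in\mathbb R^{M\times M}$ be symmetric positive definite, let $\langle u,v\rangle=v^Tu$, let $G_h:\mathbb R^M\to\mathbb R^M$ be such that the functional $v\mapsto\langle G_h(v),1\rangle$ is non-negative and differentiable with gradient $-g_h$, where $g_h:\mathbb R^M\to\mathbb R^M$ is Lipschitz continuous with constant $\ell_g>0$, and set $E[v]=\frac12\langle v,L_hv\rangle+\langle G_h(v),1\rangle$. Let $\kappa\ge2\ell_g$, $L_\kappa=L_h+\kappa I$, $g_\kappa(v)=g_h(v)+\kappa v$. From an arbitrary $u_h^0\in\mathbb R^M$ and with arbitrary step sizes $\tau=\tau_n>0$ (which may depend on $n$), let the method produce, for $n\ge1$, $U^{n,1}=u_h^{n-1}$, $$U^{n,i+1}=U^{n,1}+\sum_{j=1}^{i}a_{i+1,j}(-\tau L_\kappa)\bigl[\tau g_\kappa(U^{n,j})-\tau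 L_\kappa U^{n,1}\bigr]\quad(1\le i\le3),\qquad u_h^n=U^{n,4},$$ and write $\delta_\tau U^{n,i+1}=U^{n,i+1}-U^{n,i}$. (Functions of the symmetric matrix $-\tau L_\kappa$ are defined on its spectrum.) Then: 1. the symmetric part $\frac12\bigl(D(z)+D(z)^T\bigr)$ is positive definite for every $z<0$; 2. the energy dissipation law is preserved unconditionally (without restriction on the step sizes) at all stages: for every $n\ge1$ and $1\le j\le3$, $$E[U^{n,j+1}]-E[U^{n,1}]\le-\frac1{\tau}\sum_{k=1}^{j}\Bigl\langle\delta_\tau U^{n,k+1},\sum_{\ell=1}^{k}d_{k\ell}(-\tau L_\kappa)\,\delta_\tau U^{n,\ell+1}\Bigr\rangle\le0 .$$ -/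

import Mathlib

open scoped NNReal

noncomputable section

namespace EERK

/-! ### The exponential functions and the Butcher tableau of the two-parameter method -/

/-- The functions `φ₀(z) = exp z` and `φⱼ(z) = ∫₀¹ exp((1-s)z) s^(j-1)/(j-1)! ds` for `j ≥ 1`. -/
def phi : ℕ → ℝ → ℝ
  | 0, z => Real.exp z
  | j + 1, z => ∫ s in (0 : ℝ)..1, Real.exp ((1 - s) * z) * (s ^ j / (j.factorial : ℝ))

/-- The parameter `γ = (3c₃ - 2)c₃ / ((2 - 3c₂)c₂)` of the two-parameter family. -/
def gamma (c₂ c₃ : ℝ) : ℝ := ((3 * c₃ - 2) * c₃) / ((2 - 3 * c₂) * c₂)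

/-- The coefficient functions `a i j` (indices counted from `1`) of the three-stage method
EERK3-2 with abscissas `c₂`, `c₃`; the row `i = 4` holds the weights. -/
def coeff32 (c₂ c₃ : ℝ) : ℕ → ℕ → ℝ → ℝ
  | 2, 1, z => c₂ * phi 1 (c₂ * z)
  | 3, 1, z => c₃ * phi 1 (c₃ * z) -
      (gamma c₂ c₃ * c₂ * phi 2 (c₂ * z) + c₃ ^ 2 / c₂ * phi 2 (c₃ * z))
  | 3, 2, z => gamma c₂ c₃ * c₂ * phi 2 (c₂ * z) + c₃ ^ 2 / c₂ * phi 2 (c₃ * z)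
  | 4, 1, z => phi 1 z - gamma c₂ c₃ / (gamma c₂ c₃ * c₂ + c₃) * phi 2 z -
      1 / (gamma c₂ c₃ * c₂ + c₃) * phi 2 z
  | 4, 2, z => gamma c₂ c₃ / (gamma c₂ c₃ * c₂ + c₃) * phi 2 z
  | 4, 3, z => 1 / (gamma c₂ c₃ * c₂ + c₃) * phi 2 z
  | _, _, _ => 0

/-! ### Difference coefficients, DOC kernels and the differentiation matrix -/

/-- The difference coefficients: `diffCoeff a (i+1) i = a (i+1) i` and
`diffCoeff a (i+1) j = a (i+1) j - a i j` for `j < i`. -/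
def diffCoeff (a : ℕ → ℕ → ℝ → ℝ) : ℕ → ℕ → ℝ → ℝ
  | 0, _, _ => 0
  | i + 1, j, z => if j = i then a (i + 1) i z else if j < i then a (i + 1) j z - a i j z else 0

/-- The discrete orthogonal convolution kernels `θ k j` of a lower triangular array `b`:
`θ k k = 1 / b (k+1) k` and
`θ k j = - ∑_{ℓ=j+1}^{k} θ k ℓ * b (ℓ+1) j / b (j+1) j` for `j < k`. -/
def docKernel (b : ℕ → ℕ → ℝ) (k j : ℕ) : ℝ :=
  if j = k then 1 / b (k + 1) k
  else -∑ l ∈ (Finset.Icc (j + 1) k).attach,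
    docKernel b k l.1 * (b (l.1 + 1) j / b (j + 1) j)
termination_by k - j
decreasing_by
  have h := Finset.mem_Icc.mp l.2
  omega

theorem docKernel_self (b : ℕ → ℕ → ℝ) (k : ℕ) : docKernel b k k = 1 / b (k + 1) k := by
  rw [docKernel, if_pos rfl]

theorem docKernel_of_lt (b : ℕ → ℕ → ℝ) {k j : ℕ} (h : j < k) :
    docKernel b k j =
      -∑ l ∈ Finset.Icc (j + 1) k, docKernel b k l * (b (l + 1) j / b (j + 1) j) := by
  rw [docKernel, if_neg h.ne]
  congr 1
  exact Finset.sum_attach (Finset.Icc (j + 1) k)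
    (fun l => docKernel b k l * (b (l + 1) j / b (j + 1) j))

/-- The entries `d k ℓ` (indices counted from `1`) of the differentiation matrix of the method
with coefficients `a`: `d k ℓ = θ k ℓ + (z/2)(2 - δ k ℓ)` for `ℓ ≤ k`, and `0` for `ℓ > k`,
where the `θ` are the DOC kernels of the difference coefficients. -/
def diffEntry (a : ℕ → ℕ → ℝ → ℝ) (k l : ℕ) (z : ℝ) : ℝ :=
  if l ≤ k then
    docKernel (fun i j => diffCoeff a i j z) k l + z / 2 * (2 - if k = l then 1 else 0)
  else 0

/-- The `s × s` differentiation matrix `D(z)`. -/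
def diffMatrix (a : ℕ → ℕ → ℝ → ℝ) (s : ℕ) (z : ℝ) : Matrix (Fin s) (Fin s) ℝ :=
  Matrix.of fun k l => diffEntry a (k.val + 1) (l.val + 1) z

/-- The symmetric part `(D + Dᵀ)/2` of a matrix. -/
def symPart {s : ℕ} (D : Matrix (Fin s) (Fin s) ℝ) : Matrix (Fin s) (Fin s) ℝ :=
  (1 / 2 : ℝ) • (D + D.transpose)

/-! ### The discrete gradient system and the method -/

/-- The action of the matrix function `f(A)` on a vector, for a real symmetric matrix `A`;
`f(A)` is given by the functional calculus, that is, `f` is applied to the eigenvalues. -/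
def matFun {M : ℕ} (f : ℝ → ℝ) (A : Matrix (Fin M) (Fin M) ℝ) (v : EuclideanSpace ℝ (Fin M)) :
    EuclideanSpace ℝ (Fin M) :=
  Matrix.toEuclideanLin (cfc f A) v

/-- The functional `⟨G(v), 1⟩`. -/
def potential {M : ℕ} (G : EuclideanSpace ℝ (Fin M) → EuclideanSpace ℝ (Fin M))
    (v : EuclideanSpace ℝ (Fin M)) : ℝ :=
  ∑ i, G v i

/-- The original energy `E[v] = ½⟨v, L v⟩ + ⟨G(v), 1⟩`. -/
def energy {M : ℕ} (L : Matrix (Fin M) (Fin M) ℝ)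
    (G : EuclideanSpace ℝ (Fin M) → EuclideanSpace ℝ (Fin M))
    (v : EuclideanSpace ℝ (Fin M)) : ℝ :=
  1 / 2 * inner ℝ v (Matrix.toEuclideanLin L v) + potential G v

/-- The stabilized operator `L_κ = L + κ I`. -/
def stabL {M : ℕ} (κ : ℝ) (L : Matrix (Fin M) (Fin M) ℝ) : Matrix (Fin M) (Fin M) ℝ :=
  L + κ • (1 : Matrix (Fin M) (Fin M) ℝ)

/-- The stabilized nonlinearity `g_κ(v) = g(v) + κ v`. -/
def stabG {M : ℕ} (κ : ℝ) (g : EuclideanSpace ℝ (Fin M) → EuclideanSpace ℝ (Fin M))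
    (v : EuclideanSpace ℝ (Fin M)) : EuclideanSpace ℝ (Fin M) :=
  g v + κ • v

/-- `u n` are the numerical solutions, and `U n 1, …, U n (s+1)` the stages of the step from
`u (n-1)` to `u n` with step size `τ n`, produced by the `s`-stage explicit exponential
Runge-Kutta method with coefficients `a` for the system `u' = -L u + g(u)`. -/
structure IsSolution {M : ℕ} (s : ℕ) (a : ℕ → ℕ → ℝ → ℝ) (L : Matrix (Fin M) (Fin M) ℝ)
    (g : EuclideanSpace ℝ (Fin M) → EuclideanSpace ℝ (Fin M)) (τ : ℕ → ℝ)
    (u : ℕ → EuclideanSpace ℝ (Fin M)) (U : ℕ → ℕ → EuclideanSpace ℝ (Fin M)) : Prop where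
  first : ∀ n, 1 ≤ n → U n 1 = u (n - 1)
  stage : ∀ n, 1 ≤ n → ∀ i, 1 ≤ i → i ≤ s →
    U n (i + 1) = U n 1 + ∑ j ∈ Finset.Icc 1 i, matFun (a (i + 1) j) (-(τ n • L))
      (τ n • g (U n j) - τ n • Matrix.toEuclideanLin L (U n 1))
  last : ∀ n, 1 ≤ n → u n = U n (s + 1)

/-- The stage difference `δU^{n,i} = U^{n,i} - U^{n,i-1}` (used for `i ≥ 2`). -/
def stageDiff {M : ℕ} (U : ℕ → ℕ → EuclideanSpace ℝ (Fin M)) (n i : ℕ) :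
    EuclideanSpace ℝ (Fin M) :=
  U n i - U n (i - 1)

/-- The quadratic form
`∑_{k=1}^{j} ⟨δU^{n,k+1}, ∑_{ℓ=1}^{k} d k ℓ(A) δU^{n,ℓ+1}⟩` of the differentiation matrix. -/
def dissipation {M : ℕ} (a : ℕ → ℕ → ℝ → ℝ) (A : Matrix (Fin M) (Fin M) ℝ)
    (U : ℕ → ℕ → EuclideanSpace ℝ (Fin M)) (n j : ℕ) : ℝ :=
  ∑ k ∈ Finset.Icc 1 j, inner ℝ (stageDiff U n (k + 1))
    (∑ l ∈ Finset.Icc 1 k, matFun (diffEntry a k l) A (stageDiff U n (l + 1)))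

end EERK

end

/-!
Multiplying stage differences by `D(z)` inverts the lower triangular array `B(z)` of difference
coefficients, up to terms that telescope. In the coordinates `w = B⁻¹ v`, with `β` the sum of the
entries of `v`, twice the form `⟨v, D v⟩` is therefore `2 ⟨w, B w⟩ + z β²`.

Every `cʲ φⱼ(c z)` with `0 < c ≤ 1` is the exponential transform of an explicit kernel on `[0, 1]`,
and for `z ≤ 0` this transform is positive on non-negative kernels that are positive at `1`. Set
`r = z β`. As `z φ₁(z) = exp z - 1`, the form above exceeds `2 ⟨w, B w⟩ + 2 r β + r² φ₁(z)`, the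
transform of a kernel quadratic in `(w, r)`, by `-z exp(z) β² ≥ 0`. For `c₂ = 3/4`, `c₃ = 3/5` that
kernel is diagonally dominant at each `t ∈ [0, 1]`, so `D(z)` has positive definite symmetric part
for every `z ≤ 0`.

For the energy law, diagonalize `-τ L_κ`. Applied to the stage differences, the `k`-th row of
`D(-τ L_κ)` gives `τ (g_κ(Uₖ) - ½ L_κ (Uₖ₊₁ + Uₖ))`. On the other hand, `E` is the quadratic form of
`L_κ` plus a function that lies below its tangents as soon as `κ` is at least the Lipschitz constant
of `g`, so the energy increment of a stage is at most minus the inner product of the stage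
difference with that vector divided by `τ`.
-/

namespace EERK

theorem phi_pos (j : ℕ) (z : ℝ) : 0 < phi j z := by
  cases j with
  | zero => exact Real.exp_pos z
  | succ j =>
    refine intervalIntegral.intervalIntegral_pos_of_pos_on
      (Continuous.intervalIntegrable (by fun_prop) _ _) (fun s hs => ?_) one_pos
    have : 0 < s := hs.1
    positivity

theorem pow_mul_phi_succ (j : ℕ) (c z : ℝ) :
    c ^ (j + 1) * phi (j + 1) (c * z) =
      ∫ t in (0 : ℝ)..c, Real.exp (t * z) * ((c - t) ^ j / (j.factorial : ℝ)) := by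
  have hsubst := intervalIntegral.smul_integral_comp_sub_mul (a := 0) (b := 1)
    (fun t : ℝ => Real.exp (t * z) * ((c - t) ^ j / (j.factorial : ℝ))) c c
  rw [mul_one, sub_self, mul_zero, sub_zero, smul_eq_mul] at hsubst
  rw [← hsubst, phi, pow_succ', mul_assoc, ← intervalIntegral.integral_const_mul]
  congr 2 with s
  rw [sub_sub_cancel, mul_pow, show (1 - s) * (c * z) = (c - c * s) * z by ring]
  ring

theorem integral_exp_mul_deriv {f f' : ℝ → ℝ} {p q : ℝ} (hf : ∀ t, HasDerivAt f (f' t) t)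
    (hf' : Continuous f') (z : ℝ) :
    ∫ t in p..q, Real.exp (t * z) * f' t =
      Real.exp (q * z) * f q - Real.exp (p * z) * f p -
        z * ∫ t in p..q, Real.exp (t * z) * f t := by
  have hexp : ∀ t : ℝ, HasDerivAt (fun t => Real.exp (t * z)) (Real.exp (t * z) * z) t :=
    fun t => (hasDerivAt_mul_const z).exp
  rw [intervalIntegral.integral_mul_deriv_eq_deriv_mul (fun t _ => hexp t) (fun t _ => hf t)
    (Continuous.intervalIntegrable (by fun_prop) _ _) (hf'.intervalIntegrable _ _),
    ← intervalIntegral.integral_const_mul]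
  congr 2 with t
  ring

theorem mul_phi_one (z : ℝ) : z * phi 1 z = Real.exp z - 1 := by
  have hparts := integral_exp_mul_deriv (p := 0) (q := 1) (fun t => hasDerivAt_const t (1 : ℝ))
    continuous_const z
  have hphi := pow_mul_phi_succ 0 1 z
  simp only [mul_zero, mul_one, one_mul, zero_mul, intervalIntegral.integral_zero, zero_add,
    one_pow, pow_zero, Nat.factorial_zero, Nat.cast_one, div_one, Real.exp_zero] at hparts hphi
  rw [hphi]
  linarith

/-- The exponential transform `K ↦ exp z * K 1 - z * ∫₀¹ exp (t * z) * K t dt`. It equals the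
Stieltjes integral `∫₀¹ exp (t * z) dK(t)` when `K 0 = 0`; integrating by parts makes positivity
depend on the values of `K` rather than on its increments. -/
noncomputable def expTransform (z : ℝ) : C(ℝ, ℝ) →ₗ[ℝ] ℝ where
  toFun K := Real.exp z * K 1 - z * ∫ t in (0 : ℝ)..1, Real.exp (t * z) * K t
  map_add' K₁ K₂ := by
    simp only [ContinuousMap.add_apply, mul_add]
    rw [intervalIntegral.integral_add (Continuous.intervalIntegrable (by fun_prop) _ _)
      (Continuous.intervalIntegrable (by fun_prop) _ _)]
    ring
  map_smul' c K := by
    simp only [ContinuousMap.smul_apply, smul_eq_mul, RingHom.id_apply, mul_left_comm _ c,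
      intervalIntegral.integral_const_mul]
    ring

theorem expTransform_apply (z : ℝ) (K : C(ℝ, ℝ)) :
    expTransform z K = Real.exp z * K 1 - z * ∫ t in (0 : ℝ)..1, Real.exp (t * z) * K t :=
  rfl

theorem expTransform_pos {z : ℝ} (hz : z ≤ 0) {K : C(ℝ, ℝ)}
    (hK : ∀ t ∈ Set.Icc (0 : ℝ) 1, 0 ≤ K t) (hK₁ : 0 < K 1) : 0 < expTransform z K := by
  have hint : 0 ≤ ∫ t in (0 : ℝ)..1, Real.exp (t * z) * K t :=
    intervalIntegral.integral_nonneg zero_le_one fun t ht =>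
      mul_nonneg (Real.exp_pos _).le (hK t ht)
  have hend : 0 < Real.exp z * K 1 := mul_pos (Real.exp_pos z) hK₁
  rw [expTransform_apply]
  linarith [mul_nonpos_of_nonpos_of_nonneg hz hint]

/-- The kernel whose exponential transform is `z ↦ c ^ j * phi j (c * z)`, for `1 ≤ j` and
`0 ≤ c ≤ 1`. -/
noncomputable def phiKernel (j : ℕ) (c : ℝ) : C(ℝ, ℝ) where
  toFun t := (c ^ j - max (c - t) 0 ^ j) / (j.factorial : ℝ)

theorem phiKernel_apply (j : ℕ) (c t : ℝ) :
    phiKernel j c t = (c ^ j - max (c - t) 0 ^ j) / (j.factorial : ℝ) :=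
  rfl

theorem phiKernel_of_le (j : ℕ) {c t : ℝ} (h : t ≤ c) :
    phiKernel j c t = (c ^ j - (c - t) ^ j) / (j.factorial : ℝ) := by
  rw [phiKernel_apply, max_eq_left (sub_nonneg.mpr h)]

theorem phiKernel_succ_of_ge (j : ℕ) {c t : ℝ} (h : c ≤ t) :
    phiKernel (j + 1) c t = c ^ (j + 1) / ((j + 1).factorial : ℝ) := by
  rw [phiKernel_apply, max_eq_right (sub_nonpos.mpr h), zero_pow j.succ_ne_zero, sub_zero]

theorem hasDerivAt_sub_sub_pow_succ (j : ℕ) (c t : ℝ) :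
    HasDerivAt (fun t => (c ^ (j + 1) - (c - t) ^ (j + 1)) / ((j + 1).factorial : ℝ))
      ((c - t) ^ j / (j.factorial : ℝ)) t := by
  refine (((((hasDerivAt_id t).const_sub c).pow (j + 1)).const_sub _).div_const _).congr_deriv ?_
  rw [Nat.factorial_succ, Nat.add_sub_cancel]
  push_cast
  field_simp
  simp

theorem expTransform_phiKernel_succ (j : ℕ) {c : ℝ} (hc₀ : 0 ≤ c) (hc₁ : c ≤ 1) (z : ℝ) :
    expTransform z (phiKernel (j + 1) c) = c ^ (j + 1) * phi (j + 1) (c * z) := by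
  have hcont : Continuous fun t => Real.exp (t * z) * phiKernel (j + 1) c t := by fun_prop
  have hleft : ∫ t in (0 : ℝ)..c, Real.exp (t * z) * phiKernel (j + 1) c t =
      ∫ t in (0 : ℝ)..c, Real.exp (t * z) *
        ((c ^ (j + 1) - (c - t) ^ (j + 1)) / ((j + 1).factorial : ℝ)) :=
    intervalIntegral.integral_congr fun t ht => by
      rw [Set.uIcc_of_le hc₀] at ht
      simp only [phiKernel_of_le _ ht.2]
  have hright : ∫ t in c..1, Real.exp (t * z) * phiKernel (j + 1) c t =
      ∫ t in c..1, Real.exp (t * z) * (c ^ (j + 1) / ((j + 1).factorial : ℝ)) :=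
    intervalIntegral.integral_congr fun t ht => by
      rw [Set.uIcc_of_le hc₁] at ht
      simp only [phiKernel_succ_of_ge _ ht.1]
  have hparts₀ := integral_exp_mul_deriv (p := 0) (q := c) (hasDerivAt_sub_sub_pow_succ j c)
    (by fun_prop) z
  have hparts₁ := integral_exp_mul_deriv (p := c) (q := 1)
    (fun t => hasDerivAt_const t (c ^ (j + 1) / ((j + 1).factorial : ℝ))) continuous_const z
  rw [expTransform_apply, pow_mul_phi_succ, hparts₀, phiKernel_succ_of_ge j hc₁,
    ← intervalIntegral.integral_add_adjacent_intervals (hcont.intervalIntegrable 0 c)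
      (hcont.intervalIntegrable c 1), hleft, hright]
  simp only [sub_zero, sub_self, zero_div, mul_zero, one_mul, intervalIntegral.integral_zero,
    ne_eq, Nat.succ_ne_zero, not_false_eq_true, zero_pow] at hparts₁ ⊢
  linarith

theorem sum_docKernel_mul_eq_ite (b : ℕ → ℕ → ℝ) {j k : ℕ} (hjk : j ≤ k) (hb : b (j + 1) j ≠ 0) :
    ∑ l ∈ Finset.Icc j k, docKernel b k l * b (l + 1) j = if j = k then 1 else 0 := by
  split_ifs with h
  · subst h
    simp [docKernel_self, hb]
  · rw [← Finset.add_sum_Ioc_eq_sum_Icc hjk, ← Finset.Icc_add_one_left_eq_Ioc,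
      docKernel_of_lt b (lt_of_le_of_ne hjk h), neg_mul, neg_add_eq_zero, Finset.sum_mul]
    exact Finset.sum_congr rfl fun l _ => by rw [mul_assoc, div_mul_cancel₀ _ hb]

theorem sum_docKernel_mul {b : ℕ → ℕ → ℝ} {v w : ℕ → ℝ} {k : ℕ} (hk : 1 ≤ k)
    (hb : ∀ j ∈ Finset.Icc 1 k, b (j + 1) j ≠ 0)
    (hv : ∀ l ∈ Finset.Icc 1 k, v l = ∑ j ∈ Finset.Icc 1 l, b (l + 1) j * w j) :
    ∑ l ∈ Finset.Icc 1 k, docKernel b k l * v l = w k := by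
  calc ∑ l ∈ Finset.Icc 1 k, docKernel b k l * v l
      = ∑ l ∈ Finset.Icc 1 k, ∑ j ∈ Finset.Icc 1 l, docKernel b k l * b (l + 1) j * w j :=
        Finset.sum_congr rfl fun l hl => by simp only [hv l hl, Finset.mul_sum, mul_assoc]
    _ = ∑ j ∈ Finset.Icc 1 k, ∑ l ∈ Finset.Icc j k, docKernel b k l * b (l + 1) j * w j :=
        Finset.sum_comm' fun l j => by simp only [Finset.mem_Icc]; lia
    _ = ∑ j ∈ Finset.Icc 1 k, (if j = k then 1 else 0) * w j :=
        Finset.sum_congr rfl fun j hj => by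
          rw [← Finset.sum_mul, sum_docKernel_mul_eq_ite b (Finset.mem_Icc.mp hj).2 (hb j hj)]
    _ = w k := by simp [hk]

theorem exists_eq_sum_lowerTriangular {K : Type*} [Field K] (b : ℕ → ℕ → K) (v : ℕ → K) (s : ℕ)
    (hb : ∀ j ∈ Finset.Icc 1 s, b (j + 1) j ≠ 0) :
    ∃ w : ℕ → K, ∀ l ∈ Finset.Icc 1 s, v l = ∑ j ∈ Finset.Icc 1 l, b (l + 1) j * w j := by
  induction s with
  | zero => exact ⟨0, by simp⟩
  | succ s ih =>
    obtain ⟨w, hw⟩ := ih fun j hj => hb j (Finset.Icc_subset_Icc_right s.le_succ hj)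
    have hpivot := hb (s + 1) (Finset.right_mem_Icc.mpr (by lia))
    let x := (v (s + 1) - ∑ j ∈ Finset.Icc 1 s, b (s + 2) j * w j) / b (s + 2) (s + 1)
    have hold : ∀ m l, l ≤ s → ∑ j ∈ Finset.Icc 1 l, b m j * Function.update w (s + 1) x j =
        ∑ j ∈ Finset.Icc 1 l, b m j * w j := fun m l hl =>
      Finset.sum_congr rfl fun j hj => by
        rw [Function.update_of_ne (by have := (Finset.mem_Icc.mp hj).2; lia)]
    refine ⟨Function.update w (s + 1) x, fun l hl => ?_⟩
    obtain hls | rfl := Nat.le_succ_iff.mp (Finset.mem_Icc.mp hl).2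
    · rw [hold _ _ hls, hw l (Finset.mem_Icc.mpr ⟨(Finset.mem_Icc.mp hl).1, hls⟩)]
    · rw [Finset.sum_Icc_succ_top (by lia), hold _ _ le_rfl, Function.update_self,
        mul_div_cancel₀ _ hpivot, add_sub_cancel]

theorem two_mul_sum_mul_sum_Icc {R : Type*} [CommRing R] (v : ℕ → R) (s : ℕ) :
    2 * ∑ k ∈ Finset.Icc 1 s, v k * ∑ l ∈ Finset.Icc 1 k, v l =
      (∑ k ∈ Finset.Icc 1 s, v k) ^ 2 + ∑ k ∈ Finset.Icc 1 s, v k ^ 2 := by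
  induction s with
  | zero => simp
  | succ s ih =>
    simp only [Finset.sum_Icc_succ_top (Nat.le_add_left 1 s), mul_add, ih]
    ring

section DiffCoeff

variable (a : ℕ → ℕ → ℝ → ℝ) (z : ℝ)

theorem diffCoeff_self (k : ℕ) : diffCoeff a (k + 1) k z = a (k + 1) k z := by
  simp [diffCoeff]

theorem diffCoeff_of_lt {j k : ℕ} (h : j < k) :
    diffCoeff a (k + 1) j z = a (k + 1) j z - a k j z := by
  simp [diffCoeff, h, h.ne]

theorem sum_diffCoeff_mul (w : ℕ → ℝ) (k : ℕ) :
    ∑ j ∈ Finset.Icc 1 (k + 1), diffCoeff a (k + 2) j z * w j =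
      ∑ j ∈ Finset.Icc 1 (k + 1), a (k + 2) j z * w j -
        ∑ j ∈ Finset.Icc 1 k, a (k + 1) j z * w j := by
  have hrow : ∀ j ∈ Finset.Icc 1 k,
      diffCoeff a (k + 2) j z * w j = a (k + 2) j z * w j - a (k + 1) j z * w j := fun j hj => by
    rw [diffCoeff_of_lt a z (Nat.lt_succ_of_le (Finset.mem_Icc.mp hj).2), sub_mul]
  simp only [Finset.sum_Icc_succ_top (Nat.le_add_left 1 k), diffCoeff_self,
    Finset.sum_congr rfl hrow, Finset.sum_sub_distrib]
  ring

theorem sum_sum_diffCoeff_mul (w : ℕ → ℝ) (s : ℕ) :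
    ∑ l ∈ Finset.Icc 1 s, ∑ j ∈ Finset.Icc 1 l, diffCoeff a (l + 1) j z * w j =
      ∑ j ∈ Finset.Icc 1 s, a (s + 1) j z * w j := by
  induction s with
  | zero => simp
  | succ s ih =>
    rw [Finset.sum_Icc_succ_top (Nat.le_add_left 1 s), ih, sum_diffCoeff_mul, add_sub_cancel]

variable {a z} in
theorem sum_diffEntry_mul {v w : ℕ → ℝ} {k : ℕ} (hk : 1 ≤ k)
    (ha : ∀ j ∈ Finset.Icc 1 k, a (j + 1) j z ≠ 0)
    (hv : ∀ l ∈ Finset.Icc 1 k, v l = ∑ j ∈ Finset.Icc 1 l, diffCoeff a (l + 1) j z * w j) :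
    ∑ l ∈ Finset.Icc 1 k, diffEntry a k l z * v l =
      w k + z * ∑ l ∈ Finset.Icc 1 k, v l - z / 2 * v k := by
  have hinv := sum_docKernel_mul (b := fun i j => diffCoeff a i j z) hk
    (fun j hj => by simpa only [diffCoeff_self] using ha j hj) hv
  have hentry : ∀ l ∈ Finset.Icc 1 k, diffEntry a k l z * v l =
      docKernel (fun i j => diffCoeff a i j z) k l * v l + z * v l -
        if k = l then z / 2 * v l else 0 := fun l hl => by
    rw [diffEntry, if_pos (Finset.mem_Icc.mp hl).2]
    split_ifs <;> ring
  rw [Finset.sum_congr rfl hentry, Finset.sum_sub_distrib, Finset.sum_add_distrib, hinv,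
    ← Finset.mul_sum, Finset.sum_ite_eq, if_pos (Finset.right_mem_Icc.mpr hk)]

/-- The quadratic form `v ↦ ⟨v, D(z) v⟩` of the `s × s` differentiation matrix, on vectors with
coordinates `v 1, …, v s`. -/
noncomputable def diffForm (s : ℕ) (v : ℕ → ℝ) : ℝ :=
  ∑ k ∈ Finset.Icc 1 s, v k * ∑ l ∈ Finset.Icc 1 k, diffEntry a k l z * v l

variable {a z} in
theorem two_mul_diffForm {s : ℕ} {v w : ℕ → ℝ} (ha : ∀ j ∈ Finset.Icc 1 s, a (j + 1) j z ≠ 0)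
    (hv : ∀ l ∈ Finset.Icc 1 s, v l = ∑ j ∈ Finset.Icc 1 l, diffCoeff a (l + 1) j z * w j) :
    2 * diffForm a z s v =
      2 * ∑ k ∈ Finset.Icc 1 s, v k * w k + z * (∑ k ∈ Finset.Icc 1 s, v k) ^ 2 := by
  have hrow : ∀ k ∈ Finset.Icc 1 s, v k * ∑ l ∈ Finset.Icc 1 k, diffEntry a k l z * v l =
      v k * w k + z * (v k * ∑ l ∈ Finset.Icc 1 k, v l) - z / 2 * v k ^ 2 := fun k hk => by
    have hsub := Finset.Icc_subset_Icc_right (a := 1) (Finset.mem_Icc.mp hk).2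
    rw [sum_diffEntry_mul (Finset.mem_Icc.mp hk).1 (fun j hj => ha j (hsub hj))
      fun l hl => hv l (hsub hl)]
    ring
  rw [diffForm, Finset.sum_congr rfl hrow, Finset.sum_sub_distrib, Finset.sum_add_distrib,
    ← Finset.mul_sum, ← Finset.mul_sum]
  linear_combination z * two_mul_sum_mul_sum_Icc v s

end DiffCoeff

theorem isHermitian_symPart {s : ℕ} (D : Matrix (Fin s) (Fin s) ℝ) : (symPart D).IsHermitian := by
  rw [Matrix.IsHermitian, Matrix.conjTranspose_eq_transpose_of_trivial, symPart,
    Matrix.transpose_smul, Matrix.transpose_add, Matrix.transpose_transpose, add_comm]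

theorem dotProduct_symPart_mulVec {s : ℕ} (D : Matrix (Fin s) (Fin s) ℝ) (x : Fin s → ℝ) :
    x ⬝ᵥ (symPart D).mulVec x = x ⬝ᵥ D.mulVec x := by
  have htranspose : x ⬝ᵥ D.transpose.mulVec x = x ⬝ᵥ D.mulVec x := by
    rw [Matrix.mulVec_transpose, dotProduct_comm, Matrix.dotProduct_mulVec]
  rw [symPart, Matrix.smul_mulVec, Matrix.add_mulVec, dotProduct_smul, dotProduct_add, htranspose,
    smul_eq_mul]
  ring

theorem dotProduct_diffMatrix_mulVec (a : ℕ → ℕ → ℝ → ℝ) (z : ℝ) {s : ℕ} (v : ℕ → ℝ) :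
    (fun i : Fin s => v (i + 1)) ⬝ᵥ (diffMatrix a s z).mulVec (fun i => v (i + 1)) =
      diffForm a z s v := by
  have hshift : ∀ (f : ℕ → ℝ), ∑ k ∈ Finset.Icc 1 s, f k = ∑ i : Fin s, f (i + 1) := fun f => by
    rw [Fin.sum_univ_eq_sum_range (fun i => f (i + 1)) s, Finset.range_eq_Ico,
      Finset.sum_Ico_add' f 0 s 1, zero_add, Finset.Ico_add_one_right_eq_Icc]
  rw [diffForm, hshift]
  refine Finset.sum_congr rfl fun i _ => ?_
  have hlower : ∑ l ∈ Finset.Icc 1 (i.val + 1), diffEntry a (i + 1) l z * v l =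
      ∑ l ∈ Finset.Icc 1 s, diffEntry a (i + 1) l z * v l := by
    refine Finset.sum_subset (Finset.Icc_subset_Icc_right i.isLt) fun l hl hli => ?_
    rw [diffEntry, if_neg fun h => hli (Finset.mem_Icc.mpr ⟨(Finset.mem_Icc.mp hl).1, h⟩), zero_mul]
  rw [hlower, hshift]
  rfl

theorem posDef_symPart_diffMatrix {a : ℕ → ℕ → ℝ → ℝ} {s : ℕ} {z : ℝ}
    (h : ∀ v : ℕ → ℝ, (∃ k ∈ Finset.Icc 1 s, v k ≠ 0) → 0 < diffForm a z s v) :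
    (symPart (diffMatrix a s z)).PosDef := by
  refine Matrix.PosDef.of_dotProduct_mulVec_pos (isHermitian_symPart _) fun x hx => ?_
  obtain ⟨i, hi⟩ := Function.ne_iff.mp hx
  let v : ℕ → ℝ := fun k => if h : k - 1 < s then x ⟨k - 1, h⟩ else 0
  have hv : (fun i : Fin s => v (i + 1)) = x := by ext i; simp [v]
  rw [star_trivial, dotProduct_symPart_mulVec, ← hv, dotProduct_diffMatrix_mulVec]
  exact h v ⟨i + 1, Finset.mem_Icc.mpr ⟨Nat.le_add_left _ _, i.isLt⟩, by simpa [v] using hi⟩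

theorem diffForm_nonneg {a : ℕ → ℕ → ℝ → ℝ} {s : ℕ} {z : ℝ}
    (h : (symPart (diffMatrix a s z)).PosSemidef) {j : ℕ} (hj : j ≤ s) (v : ℕ → ℝ) :
    0 ≤ diffForm a z j v := by
  let w : ℕ → ℝ := fun k => if k ≤ j then v k else 0
  have hw : diffForm a z s w = diffForm a z j v := by
    refine (Finset.sum_subset (Finset.Icc_subset_Icc_right hj) fun k hk hkj => ?_).symm.trans
      (Finset.sum_congr rfl fun k hk => ?_)
    · have : ¬k ≤ j := fun h => hkj (Finset.mem_Icc.mpr ⟨(Finset.mem_Icc.mp hk).1, h⟩)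
      simp [w, this]
    · have hkj := (Finset.mem_Icc.mp hk).2
      refine congr_arg₂ _ (if_pos hkj) (Finset.sum_congr rfl fun l hl => ?_)
      simp only [w, if_pos ((Finset.mem_Icc.mp hl).2.trans hkj)]
  have hform := h.dotProduct_mulVec_nonneg (fun i : Fin s => w (i + 1))
  rwa [star_trivial, dotProduct_symPart_mulVec, dotProduct_diffMatrix_mulVec, hw] at hform

theorem coeff32_succ_pos {c₂ c₃ : ℝ} (hc₂ : 0 < c₂) (hc₃ : 0 < c₃) (hγ : 0 < gamma c₂ c₃) {j : ℕ}
    (hj : j ∈ Finset.Icc 1 3) (z : ℝ) : 0 < coeff32 c₂ c₃ (j + 1) j z := by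
  have hφ₁ := phi_pos 1 (c₂ * z)
  have hφ₂ := phi_pos 2
  have h₂ := hφ₂ (c₂ * z)
  have h₃ := hφ₂ (c₃ * z)
  have h₄ := hφ₂ z
  rw [Finset.mem_Icc] at hj
  obtain ⟨hj₁, hj₃⟩ := hj
  interval_cases j <;> simp only [Nat.reduceAdd, coeff32] <;> positivity

/-- The kernel whose exponential transform is the quadratic form `2 ⟨w, B w⟩ + 2 r β + r ^ 2 φ₁` of
EERK3-2, where `B` is the array of difference coefficients and `β` the sum of the entries
of `B w`. -/
noncomputable def dissipationKernel (c₂ c₃ : ℝ) (w : ℕ → ℝ) (r : ℝ) : C(ℝ, ℝ) :=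
  (2 * w 1 * (w 1 - w 2)) • phiKernel 1 c₂ + (2 * w 1 * (w 2 - w 3)) • phiKernel 1 c₃ +
    (2 * w 1 * (w 3 + r) + r ^ 2) • phiKernel 1 1 +
    (2 * (w 2 - w 1) * (w 2 - w 3) / c₂) •
      (gamma c₂ c₃ • phiKernel 2 c₂ + phiKernel 2 c₃) +
    (2 / (gamma c₂ c₃ * c₂ + c₃) *
      (gamma c₂ c₃ * w 2 + w 3 - (gamma c₂ c₃ + 1) * w 1) * (w 3 + r)) • phiKernel 2 1

theorem expTransform_dissipationKernel {c₂ c₃ : ℝ} (hc₂ : 0 < c₂) (hc₂' : c₂ ≤ 1) (hc₃ : 0 ≤ c₃)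
    (hc₃' : c₃ ≤ 1) (z : ℝ) (w : ℕ → ℝ) (r : ℝ) :
    expTransform z (dissipationKernel c₂ c₃ w r) =
      2 * ∑ k ∈ Finset.Icc 1 3,
          (∑ j ∈ Finset.Icc 1 k, diffCoeff (coeff32 c₂ c₃) (k + 1) j z * w j) * w k +
        2 * r * ∑ j ∈ Finset.Icc 1 3, coeff32 c₂ c₃ 4 j z * w j + r ^ 2 * phi 1 z := by
  have hκ₁ : expTransform z (phiKernel 1 c₂) = c₂ ^ 1 * phi 1 (c₂ * z) :=
    expTransform_phiKernel_succ 0 hc₂.le hc₂' z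
  have hκ₂ : expTransform z (phiKernel 1 c₃) = c₃ ^ 1 * phi 1 (c₃ * z) :=
    expTransform_phiKernel_succ 0 hc₃ hc₃' z
  have hκ₃ : expTransform z (phiKernel 1 1) = 1 ^ 1 * phi 1 (1 * z) :=
    expTransform_phiKernel_succ 0 zero_le_one le_rfl z
  have hκ₄ : expTransform z (phiKernel 2 c₂) = c₂ ^ 2 * phi 2 (c₂ * z) :=
    expTransform_phiKernel_succ 1 hc₂.le hc₂' z
  have hκ₅ : expTransform z (phiKernel 2 c₃) = c₃ ^ 2 * phi 2 (c₃ * z) :=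
    expTransform_phiKernel_succ 1 hc₃ hc₃' z
  have hκ₆ : expTransform z (phiKernel 2 1) = 1 ^ 2 * phi 2 (1 * z) :=
    expTransform_phiKernel_succ 1 zero_le_one le_rfl z
  simp only [dissipationKernel, map_add, map_smul, smul_eq_mul, hκ₁, hκ₂, hκ₃, hκ₄, hκ₅, hκ₆,
    one_pow, one_mul]
  simp only [Finset.sum_Icc_succ_top, Nat.reduceAdd, Nat.reduceLeDiff, Finset.Icc_self,
    Finset.sum_singleton, diffCoeff, coeff32]
  norm_num
  field_simp
  ring

/-- The last column of the bordered form is evaluated at `r = z * β`, which completes the square: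
the two sides differ by `-z * exp z * β ^ 2`. -/
theorem expTransform_dissipationKernel_le {c₂ c₃ z : ℝ} (hc₂ : 0 < c₂) (hc₂' : c₂ ≤ 1)
    (hc₃ : 0 < c₃) (hc₃' : c₃ ≤ 1) (hγ : 0 < gamma c₂ c₃) (hz : z ≤ 0) {v w : ℕ → ℝ}
    (hv : ∀ l ∈ Finset.Icc 1 3,
      v l = ∑ j ∈ Finset.Icc 1 l, diffCoeff (coeff32 c₂ c₃) (l + 1) j z * w j) :
    expTransform z (dissipationKernel c₂ c₃ w (z * ∑ k ∈ Finset.Icc 1 3, v k)) ≤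
      2 * diffForm (coeff32 c₂ c₃) z 3 v := by
  set β := ∑ k ∈ Finset.Icc 1 3, v k with hβ
  have hweights : ∑ j ∈ Finset.Icc 1 3, coeff32 c₂ c₃ 4 j z * w j = β := by
    rw [hβ, Finset.sum_congr rfl hv, sum_sum_diffCoeff_mul]
  have hrows : ∑ k ∈ Finset.Icc 1 3,
      (∑ j ∈ Finset.Icc 1 k, diffCoeff (coeff32 c₂ c₃) (k + 1) j z * w j) * w k =
        ∑ k ∈ Finset.Icc 1 3, v k * w k :=
    Finset.sum_congr rfl fun k hk => by rw [hv k hk]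
  have hgap : 0 ≤ -z * Real.exp z * β ^ 2 := by
    have : 0 ≤ -z := neg_nonneg.mpr hz
    positivity
  rw [expTransform_dissipationKernel hc₂ hc₂' hc₃.le hc₃', hrows, hweights,
    two_mul_diffForm (fun j hj => (coeff32_succ_pos hc₂ hc₃ hγ hj z).ne') hv]
  linear_combination hgap + z * β ^ 2 * mul_phi_one z

theorem mul_sum_sq_le_of_diagonallyDominant {p q r s a b c d m : ℝ} (hp : m + |a| + |d| ≤ p)
    (hq : m + |a| + |b| ≤ q) (hr : m + |b| + |c| ≤ r) (hs : m + |c| + |d| ≤ s) (x y z u : ℝ) :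
    m * (x ^ 2 + y ^ 2 + z ^ 2 + u ^ 2) ≤ p * x ^ 2 + q * y ^ 2 + r * z ^ 2 + s * u ^ 2 +
      2 * (a * (x * y) + b * (y * z) + c * (z * u) + d * (u * x)) := by
  have hcross : ∀ e x y : ℝ, 0 ≤ |e| * (x ^ 2 + y ^ 2) + 2 * (e * (x * y)) := fun e x y => by
    rcases abs_cases e with ⟨he, h⟩ | ⟨he, h⟩ <;> rw [he]
    · nlinarith [mul_nonneg h (sq_nonneg (x + y))]
    · nlinarith [mul_nonneg (neg_nonneg.mpr h.le) (sq_nonneg (x - y))]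
  linear_combination hcross a x y + hcross b y z + hcross c z u + hcross d u x +
    x ^ 2 * hp + y ^ 2 * hq + z ^ 2 * hr + u ^ 2 * hs

theorem gamma_threeQuarters_threeFifths : gamma (3 / 4) (3 / 5) = 16 / 25 := by
  norm_num [gamma]

theorem phiKernel_one_eq_min (c t : ℝ) : phiKernel 1 c t = min t c := by
  rw [phiKernel_apply, pow_one, pow_one, Nat.factorial_one, Nat.cast_one, div_one,
    ← min_sub_sub_left, sub_sub_cancel, sub_zero]

theorem phiKernel_two_of_le {c t : ℝ} (h : t ≤ c) : phiKernel 2 c t = c * t - t ^ 2 / 2 := by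
  rw [phiKernel_of_le 2 h, Nat.factorial_two]
  ring

theorem phiKernel_two_of_ge {c t : ℝ} (h : c ≤ t) : phiKernel 2 c t = c ^ 2 / 2 := by
  rw [phiKernel_succ_of_ge 1 h, Nat.factorial_two, Nat.cast_ofNat]

theorem diagonalDominance_threeQuarters_threeFifths {t S α β ε : ℝ} (ht : t ∈ Set.Icc 0 1)
    (hS : S = 64 / 75 * phiKernel 2 (3 / 4) t + 4 / 3 * phiKernel 2 (3 / 5) t)
    (hα : α = phiKernel 1 (3 / 4) t - phiKernel 1 (3 / 5) t)
    (hβ : β = 2 * t - phiKernel 1 (3 / 4) t - phiKernel 1 (3 / 5) t)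
    (hε : ε = 2 * t - 22 / 9 * phiKernel 2 1 t) :
    t / 50 + α / 4 + β / 4 ≤ t / 4 ∧
      t / 50 + α / 4 + 8 / 27 * phiKernel 2 1 t ≤ S / 2 ∧
      t / 50 + 8 / 27 * phiKernel 2 1 t + |ε| / 2 ≤ t ∧
      t / 50 + |ε| / 2 + β / 4 ≤ t - S / 2 := by
  obtain ⟨ht₀, ht₁⟩ := ht
  rw [phiKernel_one_eq_min, phiKernel_one_eq_min] at hα hβ
  rw [phiKernel_two_of_le ht₁] at hε ⊢
  rcases le_total t (3 / 5) with h₃ | h₃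
  · have h₂ : t ≤ 3 / 4 := by linarith
    rw [phiKernel_two_of_le h₂, phiKernel_two_of_le h₃] at hS
    rw [min_eq_left h₂, min_eq_left h₃] at hα hβ
    rcases abs_cases ε with ⟨habs, -⟩ | ⟨habs, -⟩ <;> rw [habs] <;> subst hS hα hβ hε <;>
      refine ⟨?_, ?_, ?_, ?_⟩ <;> nlinarith
  rw [phiKernel_two_of_ge h₃] at hS
  rw [min_eq_right h₃] at hα hβ
  rcases le_total t (3 / 4) with h₂ | h₂
  · rw [phiKernel_two_of_le h₂] at hS
    rw [min_eq_left h₂] at hα hβ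
    rcases abs_cases ε with ⟨habs, -⟩ | ⟨habs, -⟩ <;> rw [habs] <;> subst hS hα hβ hε <;>
      refine ⟨?_, ?_, ?_, ?_⟩ <;> nlinarith
  · rw [phiKernel_two_of_ge h₂] at hS
    rw [min_eq_right h₂] at hα hβ
    rcases abs_cases ε with ⟨habs, -⟩ | ⟨habs, -⟩ <;> rw [habs] <;> subst hS hα hβ hε <;>
      refine ⟨?_, ?_, ?_, ?_⟩ <;> nlinarith

/-- In these four coordinates the kernel has only the off-diagonal entries of a 4-cycle, and its
diagonal dominates them for every `t`; the margin `t / 50` gives strictness. -/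
theorem dissipationKernel_threeQuarters_threeFifths_ge {t : ℝ} (ht : t ∈ Set.Icc 0 1) (w : ℕ → ℝ)
    (r : ℝ) :
    t / 50 * ((2 * w 1) ^ 2 + (2 * w 2 - w 1 - w 3) ^ 2 + (w 3 + r) ^ 2 + (w 3 - w 1) ^ 2) ≤
      dissipationKernel (3 / 4) (3 / 5) w r t := by
  obtain ⟨hrow₁, hrow₂, hrow₃, hrow₄⟩ :=
    diagonalDominance_threeQuarters_threeFifths ht rfl rfl rfl rfl
  set S := 64 / 75 * phiKernel 2 (3 / 4) t + 4 / 3 * phiKernel 2 (3 / 5) t with hS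
  set α := phiKernel 1 (3 / 4) t - phiKernel 1 (3 / 5) t with hα
  set β := 2 * t - phiKernel 1 (3 / 4) t - phiKernel 1 (3 / 5) t with hβ
  set ε := 2 * t - 22 / 9 * phiKernel 2 1 t with hε
  have hκ : phiKernel 1 1 t = t := by rw [phiKernel_one_eq_min, min_eq_left ht.2]
  have hκ₂ : 0 ≤ phiKernel 2 1 t := by
    rw [phiKernel_two_of_le ht.2]
    nlinarith [ht.1, ht.2]
  have hα₀ : 0 ≤ α := by
    rw [hα, phiKernel_one_eq_min, phiKernel_one_eq_min, sub_nonneg]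
    exact min_le_min_left t (by norm_num)
  have hβ₀ : 0 ≤ β := by
    rw [hβ, phiKernel_one_eq_min, phiKernel_one_eq_min]
    linarith [min_le_left t (3 / 4), min_le_left t (3 / 5)]
  have hα' : |-α / 4| = α / 4 := by rw [neg_div, abs_neg, abs_of_nonneg (by positivity)]
  have hβ' : |β / 4| = β / 4 := abs_of_nonneg (by positivity)
  have hδ' : |8 / 27 * phiKernel 2 1 t| = 8 / 27 * phiKernel 2 1 t := abs_of_nonneg (by positivity)
  have hε' : |-ε / 2| = |ε| / 2 := by rw [neg_div, abs_neg, abs_div, abs_two]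
  refine (mul_sum_sq_le_of_diagonallyDominant (p := t / 4) (q := S / 2) (r := t) (s := t - S / 2)
    (a := -α / 4) (b := 8 / 27 * phiKernel 2 1 t) (c := -ε / 2) (d := β / 4)
    (by rwa [hα', hβ']) (by rwa [hα', hδ']) (by rwa [hδ', hε']) (by rwa [hε', hβ'])
    (2 * w 1) (2 * w 2 - w 1 - w 3) (w 3 + r) (w 3 - w 1)).trans_eq ?_
  simp only [dissipationKernel, gamma_threeQuarters_threeFifths, ContinuousMap.add_apply,
    ContinuousMap.smul_apply, smul_eq_mul, hκ]
  rw [hS, hα, hβ, hε]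
  ring

theorem diffForm_coeff32_pos {z : ℝ} (hz : z ≤ 0) {v : ℕ → ℝ}
    (hv : ∃ k ∈ Finset.Icc 1 3, v k ≠ 0) :
    0 < diffForm (coeff32 (3 / 4) (3 / 5)) z 3 v := by
  have hγ : 0 < gamma (3 / 4) (3 / 5) := by rw [gamma_threeQuarters_threeFifths]; norm_num
  obtain ⟨w, hw⟩ := exists_eq_sum_lowerTriangular
    (fun i j => diffCoeff (coeff32 (3 / 4) (3 / 5)) i j z) v 3 fun j hj => by
      simpa only [diffCoeff_self] using
        (coeff32_succ_pos (by norm_num) (by norm_num) hγ hj z).ne'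
  set r := z * ∑ k ∈ Finset.Icc 1 3, v k
  let N := (2 * w 1) ^ 2 + (2 * w 2 - w 1 - w 3) ^ 2 + (w 3 + r) ^ 2 + (w 3 - w 1) ^ 2
  have hN : 0 < N := by
    by_contra! hle
    have hw₁ : w 1 = 0 := by simp only [N] at hle; nlinarith
    have hw₃ : w 3 = 0 := by simp only [N] at hle; nlinarith
    have hw₂ : w 2 = 0 := by simp only [N] at hle; nlinarith
    have hwj : ∀ j, 1 ≤ j → j ≤ 3 → w j = 0 := fun j _ _ => by interval_cases j <;> assumption
    obtain ⟨k, hk, hvk⟩ := hv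
    refine hvk ((hw k hk).trans (Finset.sum_eq_zero fun j hj => ?_))
    rw [Finset.mem_Icc] at hk hj
    rw [hwj j hj.1 (hj.2.trans hk.2), mul_zero]
  have hkernel : ∀ t ∈ Set.Icc (0 : ℝ) 1, t / 50 * N ≤ dissipationKernel (3 / 4) (3 / 5) w r t :=
    fun t ht => dissipationKernel_threeQuarters_threeFifths_ge ht w r
  have htransform : 0 < expTransform z (dissipationKernel (3 / 4) (3 / 5) w r) :=
    expTransform_pos hz
      (fun t ht => (mul_nonneg (div_nonneg ht.1 (by norm_num)) hN.le).trans (hkernel t ht))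
      ((by positivity : 0 < 1 / 50 * N).trans_le (hkernel 1 (by simp)))
  linarith [expTransform_dissipationKernel_le (by norm_num) (by norm_num) (by norm_num)
    (by norm_num) hγ hz hw]

theorem posDef_symPart_diffMatrix_coeff32 {z : ℝ} (hz : z ≤ 0) :
    (symPart (diffMatrix (coeff32 (3 / 4) (3 / 5)) 3 z)).PosDef :=
  posDef_symPart_diffMatrix fun _ hv => diffForm_coeff32_pos hz hv

section Spectral

variable {M : ℕ} {A : Matrix (Fin M) (Fin M) ℝ} (hA : A.IsHermitian)

theorem matFun_eigenvectorBasis (f : ℝ → ℝ) (i : Fin M) :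
    matFun f A (hA.eigenvectorBasis i) = f (hA.eigenvalues i) • hA.eigenvectorBasis i := by
  have hcfc : (cfc f A).mulVec (hA.eigenvectorBasis i).ofLp =
      f (hA.eigenvalues i) • (hA.eigenvectorBasis i).ofLp := by
    rw [hA.cfc_eq, Matrix.IsHermitian.cfc, Unitary.conjStarAlgAut_apply, ← Matrix.mulVec_mulVec,
      hA.star_eigenvectorUnitary_mulVec i, ← Matrix.mulVec_mulVec, Matrix.diagonal_mulVec_single,
      mul_one, ← hA.eigenvectorUnitary_mulVec i, ← Matrix.mulVec_smul, ← Pi.single_smul,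
      smul_eq_mul, mul_one]
    rfl
  exact PiLp.ext (congrFun hcfc)

theorem inner_eigenvectorBasis_matFun (f : ℝ → ℝ) (i : Fin M) (v : EuclideanSpace ℝ (Fin M)) :
    inner ℝ (hA.eigenvectorBasis i) (matFun f A v) =
      f (hA.eigenvalues i) * inner ℝ (hA.eigenvectorBasis i) v := by
  have hsymm := (Matrix.isSymmetric_toEuclideanLin_iff.mpr (cfc_predicate f A))
    (hA.eigenvectorBasis i) v
  rw [matFun, ← hsymm, ← matFun, matFun_eigenvectorBasis, real_inner_smul_left]

theorem inner_eigenvectorBasis_toEuclideanLin (i : Fin M) (v : EuclideanSpace ℝ (Fin M)) :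
    inner ℝ (hA.eigenvectorBasis i) (Matrix.toEuclideanLin A v) =
      hA.eigenvalues i * inner ℝ (hA.eigenvectorBasis i) v := by
  rw [← id_eq (hA.eigenvalues i), ← inner_eigenvectorBasis_matFun, matFun,
    cfc_id ℝ A hA.isSelfAdjoint]

theorem dissipation_eq_sum_diffForm (a : ℕ → ℕ → ℝ → ℝ) (U : ℕ → ℕ → EuclideanSpace ℝ (Fin M))
    (n j : ℕ) :
    dissipation a A U n j = ∑ i, diffForm a (hA.eigenvalues i) j
      (fun k => inner ℝ (hA.eigenvectorBasis i) (stageDiff U n (k + 1))) := by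
  simp only [diffForm, dissipation]
  rw [Finset.sum_comm]
  refine Finset.sum_congr rfl fun k _ => ?_
  rw [← hA.eigenvectorBasis.sum_inner_mul_inner]
  refine Finset.sum_congr rfl fun i _ => ?_
  rw [real_inner_comm, inner_sum]
  simp only [inner_eigenvectorBasis_matFun]

end Spectral

theorem dissipation_nonneg {M : ℕ} {A : Matrix (Fin M) (Fin M) ℝ} (hA : A.IsHermitian)
    {a : ℕ → ℕ → ℝ → ℝ} {s j : ℕ}
    (hD : ∀ z ∈ spectrum ℝ A, (symPart (diffMatrix a s z)).PosSemidef) (hj : j ≤ s)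
    (U : ℕ → ℕ → EuclideanSpace ℝ (Fin M)) (n : ℕ) : 0 ≤ dissipation a A U n j := by
  rw [dissipation_eq_sum_diffForm hA]
  exact Finset.sum_nonneg fun i _ =>
    diffForm_nonneg (hD _ (hA.eigenvalues_mem_spectrum_real i)) hj _

theorem nonpos_of_mem_spectrum_neg {M : ℕ} {B : Matrix (Fin M) (Fin M) ℝ} (hB : B.PosSemidef)
    {z : ℝ} (hz : z ∈ spectrum ℝ (-B)) : z ≤ 0 := by
  rw [← spectrum.neg_eq, Set.mem_neg, hB.isHermitian.spectrum_real_eq_range_eigenvalues] at hz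
  obtain ⟨i, hi⟩ := hz
  linarith [hB.eigenvalues_nonneg i]

theorem sum_diffEntry_mul_stage_sub {a : ℕ → ℕ → ℝ → ℝ} {z : ℝ} {u N : ℕ → ℝ} {k : ℕ} (hk : 1 ≤ k)
    (ha : ∀ j ∈ Finset.Icc 1 k, a (j + 1) j z ≠ 0)
    (hu : ∀ i, 1 ≤ i → i ≤ k →
      u (i + 1) = u 1 + ∑ j ∈ Finset.Icc 1 i, a (i + 1) j z * (N j + z * u 1)) :
    ∑ l ∈ Finset.Icc 1 k, diffEntry a k l z * (u (l + 1) - u l) =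
      N k + z / 2 * (u (k + 1) + u k) := by
  have hdiff : ∀ l ∈ Finset.Icc 1 k, u (l + 1) - u l =
      ∑ j ∈ Finset.Icc 1 l, diffCoeff a (l + 1) j z * (N j + z * u 1) := fun l hl => by
    obtain ⟨hl₁, hlk⟩ := Finset.mem_Icc.mp hl
    obtain ⟨m, rfl⟩ := Nat.exists_eq_add_of_le' hl₁
    have hprev : u (m + 1) = u 1 + ∑ j ∈ Finset.Icc 1 m, a (m + 1) j z * (N j + z * u 1) := by
      rcases Nat.eq_zero_or_pos m with rfl | hm
      · simp
      · exact hu m hm (by lia)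
    rw [hu (m + 1) hl₁ hlk, hprev, sum_diffCoeff_mul a z (fun j => N j + z * u 1)]
    ring
  rw [sum_diffEntry_mul hk ha hdiff, Finset.sum_Icc_sub hk]
  ring

theorem IsSolution.sum_matFun_diffEntry_stageDiff {M s : ℕ} {a : ℕ → ℕ → ℝ → ℝ}
    {L : Matrix (Fin M) (Fin M) ℝ} {g : EuclideanSpace ℝ (Fin M) → EuclideanSpace ℝ (Fin M)}
    {τ : ℕ → ℝ} {u : ℕ → EuclideanSpace ℝ (Fin M)} {U : ℕ → ℕ → EuclideanSpace ℝ (Fin M)}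
    (hsol : IsSolution s a L g τ u U) {n k : ℕ} (hn : 1 ≤ n) (hk : 1 ≤ k) (hks : k ≤ s)
    (hL : L.IsHermitian)
    (ha : ∀ z ∈ spectrum ℝ (-(τ n • L)), ∀ j ∈ Finset.Icc 1 k, a (j + 1) j z ≠ 0) :
    ∑ l ∈ Finset.Icc 1 k, matFun (diffEntry a k l) (-(τ n • L)) (stageDiff U n (l + 1)) =
      τ n • (g (U n k) - (1 / 2 : ℝ) • Matrix.toEuclideanLin L (U n (k + 1) + U n k)) := by
  have hA : (-(τ n • L)).IsHermitian := (hL.smul (.all (τ n))).neg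
  refine hA.eigenvectorBasis.repr.injective (PiLp.ext fun i => ?_)
  rw [hA.eigenvectorBasis.repr_apply_apply, hA.eigenvectorBasis.repr_apply_apply]
  have hlin : ∀ v, τ n * inner ℝ (hA.eigenvectorBasis i) (Matrix.toEuclideanLin L v) =
      -(hA.eigenvalues i * inner ℝ (hA.eigenvectorBasis i) v) := fun v => by
    rw [← inner_eigenvectorBasis_toEuclideanLin hA, map_neg, map_smul, LinearMap.neg_apply,
      LinearMap.smul_apply, inner_neg_right, neg_neg, real_inner_smul_right]
  have hrow := sum_diffEntry_mul_stage_sub (u := fun m => inner ℝ (hA.eigenvectorBasis i) (U n m))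
    (N := fun m => τ n * inner ℝ (hA.eigenvectorBasis i) (g (U n m))) hk
    (ha _ (hA.eigenvalues_mem_spectrum_real i)) fun m hm hmk => by
      simp only [hsol.stage n hn m hm (hmk.trans hks), inner_add_right, inner_sum,
        inner_eigenvectorBasis_matFun, inner_sub_right, real_inner_smul_right, hlin,
        sub_neg_eq_add]
  simp only [inner_sum, inner_eigenvectorBasis_matFun, stageDiff, Nat.add_sub_cancel,
    inner_sub_right, real_inner_smul_right]
  rw [hrow, mul_sub, mul_left_comm, hlin, inner_add_right]
  ring

section Energy

variable {E : Type*} [NormedAddCommGroup E] [InnerProductSpace ℝ E]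

theorem le_add_inner_add_of_lipschitzWith_gradient [CompleteSpace E] {f : E → ℝ} {f' : E → E}
    {K : ℝ≥0} (hf : ∀ v, HasGradientAt f (f' v) v) (hf' : LipschitzWith K f') (v w : E) :
    f w ≤ f v + inner ℝ (f' v) (w - v) + K / 2 * ‖w - v‖ ^ 2 := by
  set d := w - v with hd
  let h : ℝ → ℝ := fun t => f (v + t • d) - t * inner ℝ (f' v) d - K / 2 * ‖d‖ ^ 2 * t ^ 2
  have hderiv : ∀ t, HasDerivAt h
      (inner ℝ (f' (v + t • d) - f' v) d - K * ‖d‖ ^ 2 * t) t := fun t => by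
    have hline : HasDerivAt (fun t : ℝ => v + t • d) d t := by
      simpa using ((hasDerivAt_id t).smul_const d).const_add v
    refine ((((hf (v + t • d)).hasFDerivAt.comp_hasDerivAt t hline).sub
      ((hasDerivAt_id t).mul_const (inner ℝ (f' v) d))).sub
      (((hasDerivAt_id t).pow 2).const_mul (K / 2 * ‖d‖ ^ 2))).congr_deriv ?_
    simp only [InnerProductSpace.toDual_apply_apply, inner_sub_left, id_eq, Nat.cast_ofNat]
    ring
  have hgrowth : ∀ t, 0 ≤ t → inner ℝ (f' (v + t • d) - f' v) d ≤ K * ‖d‖ ^ 2 * t := fun t ht =>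
    calc inner ℝ (f' (v + t • d) - f' v) d
        ≤ ‖f' (v + t • d) - f' v‖ * ‖d‖ := real_inner_le_norm _ _
      _ ≤ K * ‖v + t • d - v‖ * ‖d‖ := by gcongr; exact hf'.norm_sub_le _ _
      _ = K * ‖d‖ ^ 2 * t := by
        rw [add_sub_cancel_left, norm_smul, Real.norm_of_nonneg ht]
        ring
  have hanti : AntitoneOn h (Set.Icc 0 1) := by
    refine antitoneOn_of_deriv_nonpos (convex_Icc 0 1)
      (fun t _ => (hderiv t).continuousAt.continuousWithinAt)
      (fun t _ => (hderiv t).differentiableAt.differentiableWithinAt) fun t ht => ?_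
    rw [interior_Icc] at ht
    rw [(hderiv t).deriv, sub_nonpos]
    exact hgrowth t ht.1.le
  have hends := hanti (Set.left_mem_Icc.mpr zero_le_one) (Set.right_mem_Icc.mpr zero_le_one)
    zero_le_one
  simp only [h, zero_smul, add_zero, one_smul, hd, add_sub_cancel] at hends
  linarith

theorem sub_half_mul_norm_sq_le [CompleteSpace E] {f : E → ℝ} {f' : E → E} {K : ℝ≥0} {κ : ℝ}
    (hf : ∀ v, HasGradientAt f (f' v) v) (hf' : LipschitzWith K f') (hκ : (K : ℝ) ≤ κ) (v w : E) :
    f w - κ / 2 * ‖w‖ ^ 2 ≤ f v - κ / 2 * ‖v‖ ^ 2 + inner ℝ (f' v - κ • v) (w - v) := by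
  have hdescent : f w ≤ f v + inner ℝ (f' v) (w - v) + κ / 2 * ‖w - v‖ ^ 2 :=
    (le_add_inner_add_of_lipschitzWith_gradient hf hf' v w).trans (by gcongr)
  have hnorm : ‖w‖ ^ 2 = ‖v‖ ^ 2 + 2 * inner ℝ v (w - v) + ‖w - v‖ ^ 2 := by
    rw [← norm_add_sq_real, add_sub_cancel]
  rw [inner_sub_left, real_inner_smul_left]
  linear_combination hdescent - κ / 2 * hnorm

theorem inner_map_self_sub_inner_map_self {T : E →ₗ[ℝ] E} (hT : T.IsSymmetric) (v w : E) :
    inner ℝ w (T w) - inner ℝ v (T v) = inner ℝ (w - v) (T (w + v)) := by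
  have hcross : inner ℝ w (T v) = inner ℝ v (T w) := by rw [← hT, real_inner_comm]
  rw [map_add, inner_add_right, inner_sub_left, inner_sub_left, hcross]
  ring

variable {M : ℕ} {L : Matrix (Fin M) (Fin M) ℝ}
  {g G : EuclideanSpace ℝ (Fin M) → EuclideanSpace ℝ (Fin M)} {lip : ℝ≥0} {κ : ℝ}

theorem energy_eq_stabL_add (κ : ℝ) (L : Matrix (Fin M) (Fin M) ℝ)
    (G : EuclideanSpace ℝ (Fin M) → EuclideanSpace ℝ (Fin M)) (v : EuclideanSpace ℝ (Fin M)) :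
    energy L G v = 1 / 2 * inner ℝ v (Matrix.toEuclideanLin (stabL κ L) v) +
      (potential G v - κ / 2 * ‖v‖ ^ 2) := by
  have hstab : Matrix.toEuclideanLin (stabL κ L) v = Matrix.toEuclideanLin L v + κ • v := by
    simp [stabL]
  rw [hstab, inner_add_right, real_inner_smul_right, real_inner_self_eq_norm_sq, energy]
  ring

theorem energy_sub_le (hL : (stabL κ L).IsHermitian)
    (hG : ∀ v, HasGradientAt (potential G) (-(g v)) v) (hg : LipschitzWith lip g)
    (hκ : (lip : ℝ) ≤ κ) (v w : EuclideanSpace ℝ (Fin M)) :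
    energy L G w - energy L G v ≤ -inner ℝ (w - v)
      (stabG κ g v - (1 / 2 : ℝ) • Matrix.toEuclideanLin (stabL κ L) (w + v)) := by
  have hconcave := sub_half_mul_norm_sq_le hG hg.neg hκ v w
  have hquad := inner_map_self_sub_inner_map_self (Matrix.isSymmetric_toEuclideanLin_iff.mpr hL) v w
  have htangent : inner ℝ (-(g v) - κ • v) (w - v) = -inner ℝ (w - v) (stabG κ g v) := by
    rw [stabG, real_inner_comm, ← inner_neg_right, neg_add']
  rw [energy_eq_stabL_add κ, energy_eq_stabL_add κ, inner_sub_right, real_inner_smul_right]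
  linear_combination hconcave + 1 / 2 * hquad + htangent

variable {s : ℕ} {a : ℕ → ℕ → ℝ → ℝ} {τ : ℕ → ℝ} {u : ℕ → EuclideanSpace ℝ (Fin M)}
  {U : ℕ → ℕ → EuclideanSpace ℝ (Fin M)}

theorem IsSolution.energy_sub_le_dissipation
    (hsol : IsSolution s a (stabL κ L) (stabG κ g) τ u U)
    (hG : ∀ v, HasGradientAt (potential G) (-(g v)) v) (hg : LipschitzWith lip g)
    (hκ : (lip : ℝ) ≤ κ) {n j : ℕ} (hn : 1 ≤ n) (hτ : 0 < τ n) (hj : j ≤ s)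
    (hL : (stabL κ L).IsHermitian)
    (ha : ∀ z ∈ spectrum ℝ (-(τ n • stabL κ L)), ∀ k ∈ Finset.Icc 1 s, a (k + 1) k z ≠ 0) :
    energy L G (U n (j + 1)) - energy L G (U n 1) ≤
      -(1 / τ n) * dissipation a (-(τ n • stabL κ L)) U n j := by
  have hstage : ∀ k ∈ Finset.Icc 1 j, energy L G (U n (k + 1)) - energy L G (U n k) ≤
      -(1 / τ n) * inner ℝ (stageDiff U n (k + 1)) (∑ l ∈ Finset.Icc 1 k,
        matFun (diffEntry a k l) (-(τ n • stabL κ L)) (stageDiff U n (l + 1))) := fun k hk => by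
    obtain ⟨hk₁, hkj⟩ := Finset.mem_Icc.mp hk
    rw [hsol.sum_matFun_diffEntry_stageDiff hn hk₁ (hkj.trans hj) hL fun z hz m hm =>
      ha z hz m (Finset.Icc_subset_Icc_right (hkj.trans hj) hm), real_inner_smul_right, neg_mul,
      one_div, inv_mul_cancel_left₀ hτ.ne']
    exact energy_sub_le hL hG hg hκ (U n k) (U n (k + 1))
  rcases Nat.eq_zero_or_pos j with rfl | hj₁
  · simp [dissipation]
  · rw [← Finset.sum_Icc_sub hj₁ (fun k => energy L G (U n k)), dissipation, Finset.mul_sum]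
    exact Finset.sum_le_sum hstage

theorem IsSolution.energy_dissipation (hsol : IsSolution s a (stabL κ L) (stabG κ g) τ u U)
    (hL : (stabL κ L).PosSemidef) (hG : ∀ v, HasGradientAt (potential G) (-(g v)) v)
    (hg : LipschitzWith lip g) (hκ : (lip : ℝ) ≤ κ)
    (ha : ∀ z ≤ 0, ∀ k ∈ Finset.Icc 1 s, a (k + 1) k z ≠ 0)
    (hD : ∀ z ≤ 0, (symPart (diffMatrix a s z)).PosSemidef)
    {n j : ℕ} (hn : 1 ≤ n) (hτ : 0 < τ n) (hj : j ≤ s) :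
    energy L G (U n (j + 1)) - energy L G (U n 1) ≤
        -(1 / τ n) * dissipation a (-(τ n • stabL κ L)) U n j ∧
      -(1 / τ n) * dissipation a (-(τ n • stabL κ L)) U n j ≤ 0 := by
  have hτL : (τ n • stabL κ L).PosSemidef := hL.smul hτ.le
  have hspec : ∀ z ∈ spectrum ℝ (-(τ n • stabL κ L)), z ≤ 0 := fun _ =>
    nonpos_of_mem_spectrum_neg hτL
  refine ⟨hsol.energy_sub_le_dissipation hG hg hκ hn hτ hj hL.isHermitian
    fun z hz => ha z (hspec z hz), ?_⟩
  rw [neg_mul, neg_nonpos]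
  exact mul_nonneg (one_div_pos.mpr hτ).le
    (dissipation_nonneg hτL.isHermitian.neg (fun z hz => hD z (hspec z hz)) hj U n)

end Energy

end EERK

theorem mainTheorem8_general :
    (∀ z ≤ 0, (EERK.symPart (EERK.diffMatrix (EERK.coeff32 (3 / 4) (3 / 5)) 3 z)).PosDef) ∧
    ∀ (M : ℕ) (L : Matrix (Fin M) (Fin M) ℝ)
      (g G : EuclideanSpace ℝ (Fin M) → EuclideanSpace ℝ (Fin M))
      (lip : ℝ≥0) (κ : ℝ) (τ : ℕ → ℝ)
      (u : ℕ → EuclideanSpace ℝ (Fin M)) (U : ℕ → ℕ → EuclideanSpace ℝ (Fin M)),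
      (EERK.stabL κ L).PosSemidef →
      (∀ v, HasGradientAt (EERK.potential G) (-(g v)) v) →
      LipschitzWith lip g →
      lip ≤ κ →
      (∀ n, 1 ≤ n → 0 < τ n) →
      EERK.IsSolution 3 (EERK.coeff32 (3 / 4) (3 / 5)) (EERK.stabL κ L) (EERK.stabG κ g) τ u U →
      ∀ n, 1 ≤ n → ∀ j ≤ 3,
        EERK.energy L G (U n (j + 1)) - EERK.energy L G (U n 1) ≤
            -(1 / τ n) * EERK.dissipation (EERK.coeff32 (3 / 4) (3 / 5))
              (-(τ n • EERK.stabL κ L)) U n j ∧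
          -(1 / τ n) * EERK.dissipation (EERK.coeff32 (3 / 4) (3 / 5))
              (-(τ n • EERK.stabL κ L)) U n j ≤ 0 := by
  have hD := fun z (hz : z ≤ 0) => EERK.posDef_symPart_diffMatrix_coeff32 hz
  refine ⟨hD, fun M L g G lip κ τ u U hL hG hg hκ hτ hsol n hn j hj => ?_⟩
  refine hsol.energy_dissipation hL hG hg hκ (fun z _ k hk => ?_) (fun z hz => (hD z hz).posSemidef)
    hn (hτ n hn) hj
  exact (EERK.coeff32_succ_pos (by norm_num) (by norm_num)
    (by norm_num [EERK.gamma_threeQuarters_threeFifths]) hk z).ne'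

theorem mainTheorem8 :
    (∀ z : ℝ, z < 0 →
      (EERK.symPart (EERK.diffMatrix (EERK.coeff32 (3 / 4) (3 / 5)) 3 z)).PosDef) ∧
    ∀ (M : ℕ) (L : Matrix (Fin M) (Fin M) ℝ)
      (g G : EuclideanSpace ℝ (Fin M) → EuclideanSpace ℝ (Fin M))
      (lip : ℝ≥0) (κ : ℝ) (τ : ℕ → ℝ)
      (u : ℕ → EuclideanSpace ℝ (Fin M)) (U : ℕ → ℕ → EuclideanSpace ℝ (Fin M)),
      L.PosDef →
      (∀ v, 0 ≤ EERK.potential G v) →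
      (∀ v, HasGradientAt (EERK.potential G) (-(g v)) v) →
      0 < lip → LipschitzWith lip g →
      2 * (lip : ℝ) ≤ κ →
      (∀ n, 1 ≤ n → 0 < τ n) →
      EERK.IsSolution 3 (EERK.coeff32 (3 / 4) (3 / 5)) (EERK.stabL κ L) (EERK.stabG κ g) τ u U →
      ∀ n, 1 ≤ n → ∀ j, 1 ≤ j → j ≤ 3 →
        EERK.energy L G (U n (j + 1)) - EERK.energy L G (U n 1) ≤
            -(1 / τ n) * EERK.dissipation (EERK.coeff32 (3 / 4) (3 / 5))
              (-(τ n • EERK.stabL κ L)) U n j ∧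
          -(1 / τ n) * EERK.dissipation (EERK.coeff32 (3 / 4) (3 / 5))
              (-(τ n • EERK.stabL κ L)) U n j ≤ 0 := by
  refine ⟨fun z hz => mainTheorem8_general.1 z hz.le,
    fun M L g G lip κ τ u U hL _ hG _ hg hκ hτ hsol n hn j _ hj => ?_⟩
  have hκ₀ : 0 ≤ κ := (by positivity : (0 : ℝ) ≤ 2 * lip).trans hκ
  exact mainTheorem8_general.2 M L g G lip κ τ u U (hL.posSemidef.add (.smul .one hκ₀)) hG hg
    (by linarith [lip.coe_nonneg]) hτ hsol n hn j hj
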